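/- Let $n\ge 1$, $0\le\gamma<1$ and $\alpha=\frac{4}{3+\gamma}$. Let $\Omega\subset\mathbb R^n$ be a bounded domain (open connected set) and, for some $\delta>0$, let $\mathcal B:\mathbb R\to\mathbb R$ be a Lipschitz function with $0\le\mathcal B\le 1$ on $[0,\infty)$, $\mathcal B=0$ on $(-\infty,\delta/2]$ and $\mathcal B=1$ on $[\delta,\infty)$; for $\varepsilon>0$ put $\mathcal B_\varepsilon(s)=\mathcal B(s/\varepsilon^\alpha)$. Write $\Delta_\infty v=\sum_{i,j}D_{ij}v\,D_iv\,D_jv$. For boundary data $\varphi_\varepsilon\ge 0$ on $\partial\Omega$, consider the problem $$(P_\varepsilon)\qquad \Delta_\infty v=\mathcal B_\varepsilon(v)\,v^{-\gamma}\ \text{ in }\Omega,\qquad v=\varphi_\varepsilon\ \text{ on }\partial\Omega,$$ where the right-hand side is read as $0$ wherever $v\le 0$ and the equation is understood in the viscosity sense. The minimal solution of $(P_\varepsilon)$ is the viscosity solution $u_\varepsilon\in C(\overline\Omega)$ that satisfies $u_\varepsilon\le w$ for every viscosity supersolution $w\in C(\overline\Omega)$ of the equation with $w=\varphi_\varepsilon$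 on $\partial\Omega$. A function $u:\overline\Omega\to\mathbb R$ with $u=\varphi$ on $\partial\Omega$ is called a limit solution if there are $\varepsilon_k\to0^+$ and boundary data $\varphi_{\varepsilon_k}\ge 0$ with $\varphi_{\varepsilon_k}\to\varphi$ pointwise on $\partial\Omega$ such that the minimal solutions $u_{\varepsilon_k}$ of $(P_{\varepsilon_k})$ exist and converge to $u$ locally uniformly in $\Omega$. **Proposition.** For all $n\ge1$, $0\le\gamma<1$, $M\ge 0$ and $d>0$ there exist constants $C>0$ and $r_0>0$, depending only on $n,\gamma,M,d$, such that the following holds for all $\delta,\mathcal B,\Omega,\varphi$ as above, every limit solution $u$ with $\|u\|_{L^\infty(\Omega)}\le M$, and every subdomain $\Omega'\Subset\Omega$ with $\operatorname{dist}(\Omega',\partial\Omega)\ge d$: for every $0<r\le r_0$ and every $$x\in\overline{\{y\in\Omega: u(y)<r^\alpha\}}\cap\Omega'$$ one has $B_r(x)\subset\Omega$ and $$\sup_{B_r(x)}u\le C\,r^\alpha .$$ -/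

import Mathlib

open Set Filter Topology MeasureTheory
open scoped ENNReal

noncomputable section

namespace SingularInfinity

/-- The exponent `α = 4 / (3 + γ)`. -/
def alpha (γ : ℝ) : ℝ := 4 / (3 + γ)

/-- The infinity Laplacian `∑ i j, D_ij ψ D_i ψ D_j ψ = ⟨D²ψ Dψ, Dψ⟩` of a function on `ℝⁿ`. -/
def infinityLaplacian {n : ℕ} (ψ : EuclideanSpace ℝ (Fin n) → ℝ)
    (x : EuclideanSpace ℝ (Fin n)) : ℝ :=
  fderiv ℝ (fderiv ℝ ψ) x (gradient ψ x) (gradient ψ x)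

/-- `u` is a viscosity subsolution of `Δ_∞ u = f(u)` in the open set `Ω`: whenever a `C²` function
`ψ` touches `u` from above at a point of `Ω`, one has `Δ_∞ ψ ≥ f(u)` there. -/
def IsViscositySubsolution {n : ℕ} (f : ℝ → ℝ) (Ω : Set (EuclideanSpace ℝ (Fin n)))
    (u : EuclideanSpace ℝ (Fin n) → ℝ) : Prop :=
  ∀ x ∈ Ω, ∀ ψ : EuclideanSpace ℝ (Fin n) → ℝ, ContDiffAt ℝ 2 ψ x →
    IsLocalMax (fun y => u y - ψ y) x → f (u x) ≤ infinityLaplacian ψ x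

/-- `u` is a viscosity supersolution of `Δ_∞ u = f(u)` in the open set `Ω`: whenever a `C²` function
`ψ` touches `u` from below at a point of `Ω`, one has `Δ_∞ ψ ≤ f(u)` there. -/
def IsViscositySupersolution {n : ℕ} (f : ℝ → ℝ) (Ω : Set (EuclideanSpace ℝ (Fin n)))
    (u : EuclideanSpace ℝ (Fin n) → ℝ) : Prop :=
  ∀ x ∈ Ω, ∀ ψ : EuclideanSpace ℝ (Fin n) → ℝ, ContDiffAt ℝ 2 ψ x →
    IsLocalMin (fun y => u y - ψ y) x → infinityLaplacian ψ x ≤ f (u x)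

/-- The profile `𝓑` of the penalization: a Lipschitz function with `0 ≤ 𝓑 ≤ 1` on `[0, ∞)`,
`𝓑 = 0` on `(-∞, δ/2]` and `𝓑 = 1` on `[δ, ∞)`. -/
structure IsPenalization (δ : ℝ) (B : ℝ → ℝ) : Prop where
  lipschitz : ∃ K, LipschitzWith K B
  mem_Icc : ∀ s, 0 ≤ s → B s ∈ Icc (0 : ℝ) 1
  eq_zero : ∀ s, s ≤ δ / 2 → B s = 0
  eq_one : ∀ s, δ ≤ s → B s = 1

/-- The source term `𝓑_ε(s) s^{-γ}`, where `𝓑_ε(s) = 𝓑(s / ε^α)`. For a penalization profile `𝓑`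
and `ε > 0` it vanishes for all `s ≤ (δ/2) ε^α`, so the values given to `s ^ (-γ)` at `s ≤ 0`
play no role. -/
def source (γ : ℝ) (B : ℝ → ℝ) (ε s : ℝ) : ℝ :=
  B (s / ε ^ alpha γ) * s ^ (-γ)

/-- The class of competitors: functions `w ∈ C(closure Ω)` with `w = φ` on `∂Ω` that are viscosity
supersolutions of `Δ_∞ w = f(w)` in `Ω`. -/
structure IsCompetitor {n : ℕ} (f : ℝ → ℝ) (Ω : Set (EuclideanSpace ℝ (Fin n)))
    (φ w : EuclideanSpace ℝ (Fin n) → ℝ) : Prop where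
  continuousOn : ContinuousOn w (closure Ω)
  boundary : ∀ x ∈ frontier Ω, w x = φ x
  supersolution : IsViscositySupersolution f Ω w

/-- `v` is the minimal (Perron) viscosity solution in `C(closure Ω)` of the Dirichlet problem
`Δ_∞ v = f(v)` in `Ω`, `v = φ` on `∂Ω`: it is a viscosity solution with these boundary values,
and it is the smallest of all supersolutions with these boundary values. -/
structure IsMinimalSolution {n : ℕ} (f : ℝ → ℝ) (Ω : Set (EuclideanSpace ℝ (Fin n)))
    (φ v : EuclideanSpace ℝ (Fin n) → ℝ) : Prop where
  isCompetitor : IsCompetitor f Ω φ v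
  subsolution : IsViscositySubsolution f Ω v
  minimal : ∀ w, IsCompetitor f Ω φ w → ∀ x ∈ closure Ω, v x ≤ w x

/-- `u` is a limit solution with boundary values `φ`: the locally uniform limit in `Ω` of minimal
solutions `v k` of `Δ_∞ v = 𝓑_ε(v) v^{-γ}` in `Ω`, `v = φ_ε` on `∂Ω`, along some sequence of
parameters `ε = ε k → 0⁺`, the boundary data `φ_ε = φ' k ≥ 0` converging to `φ` on `∂Ω`. -/
def IsLimitSolution {n : ℕ} (γ : ℝ) (B : ℝ → ℝ) (Ω : Set (EuclideanSpace ℝ (Fin n)))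
    (φ u : EuclideanSpace ℝ (Fin n) → ℝ) : Prop :=
  (∀ x ∈ frontier Ω, u x = φ x) ∧
  ∃ (ε : ℕ → ℝ) (φ' v : ℕ → EuclideanSpace ℝ (Fin n) → ℝ),
    (∀ k, 0 < ε k) ∧ Tendsto ε atTop (𝓝 0) ∧
    (∀ k, ∀ x ∈ frontier Ω, 0 ≤ φ' k x) ∧
    (∀ x ∈ frontier Ω, Tendsto (fun k => φ' k x) atTop (𝓝 (φ x))) ∧
    (∀ k, IsMinimalSolution (source γ B (ε k)) Ω (φ' k) (v k)) ∧
    TendstoLocallyUniformlyOn v u atTop Ω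

end SingularInfinity

end

namespace SingularInfinity

/-! The power `w ^ (1 / α)` of a positive supersolution of `Δ_∞ w = c w ^ (-γ)` is Lipschitz. The
barrier `A (m - |p - y|) ^ α` satisfies the equation with `A ^ (3 + γ) α ^ 3 (α - 1)` in place of
`c`. As `α > 1`, a large `A` makes this constant exceed `c`, so the barrier cannot touch `w` from
below away from `y`. Hence `(w / A) ^ (1 / α) + |p - y|` is minimal at `y` (`rpow_inv_le_add_dist`).

The penalized solutions are nonnegative, and raising them by `(δ / 2) ε ^ α` makes them positive
supersolutions with `c = 2`, uniformly in `δ`, `𝓑` and `ε`. The estimate passes to the limit; with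
`u x ≤ r ^ α` it gives `u y ≤ C r ^ α` when `|x - y| < r`. -/

lemma one_lt_alpha {γ : ℝ} (hγ0 : 0 ≤ γ) (hγ1 : γ < 1) : 1 < alpha γ := by
  unfold alpha
  rw [lt_div_iff₀ (by linarith)]
  linarith

/-! ### Radial functions and the barrier argument -/

/-- The infinity Laplacian of a radial function `p ↦ g ‖p - q‖` is `g'' g' ^ 2`. -/
lemma infinityLaplacian_radial {n : ℕ} {g : ℝ → ℝ} {q x : EuclideanSpace ℝ (Fin n)}
    (hx : x ≠ q) {g₁ : ℝ → ℝ} {g₂ : ℝ}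
    (hg : ∀ᶠ s in 𝓝 ‖x - q‖, HasDerivAt g (g₁ s) s) (hg₁ : HasDerivAt g₁ g₂ ‖x - q‖)
    (hψ : ContDiffAt ℝ 2 (fun p => g ‖p - q‖) x) :
    infinityLaplacian (fun p => g ‖p - q‖) x = g₂ * g₁ ‖x - q‖ ^ 2 := by
  have hR : 0 < ‖x - q‖ := norm_pos_iff.2 (sub_ne_zero.2 hx)
  have key : ∀ p : EuclideanSpace ℝ (Fin n), p ≠ q → HasDerivAt g (g₁ ‖p - q‖) ‖p - q‖ →
      HasFDerivAt (fun p => g ‖p - q‖)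
        ((g₁ ‖p - q‖ / ‖p - q‖) • innerSL ℝ (p - q)) p := by
    intro p hp hgp
    have hpos : 0 < ‖p - q‖ := norm_pos_iff.2 (sub_ne_zero.2 hp)
    have h1 : HasFDerivAt (fun p : EuclideanSpace ℝ (Fin n) => ‖p - q‖ ^ 2)
        (2 • innerSL ℝ (p - q)) p := by
      simpa using ((hasFDerivAt_id p).sub_const q).norm_sq
    have h2 := h1.sqrt (by positivity)
    have h3 : HasFDerivAt (fun p : EuclideanSpace ℝ (Fin n) => ‖p - q‖)
        ((1 / ‖p - q‖) • innerSL ℝ (p - q)) p := by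
      have e : (fun p : EuclideanSpace ℝ (Fin n) => √(‖p - q‖ ^ 2)) = fun p => ‖p - q‖ := by
        funext p
        exact Real.sqrt_sq (norm_nonneg _)
      rw [e, Real.sqrt_sq hpos.le] at h2
      refine h2.congr_fderiv ?_
      ext v
      simp only [smul_apply, smul_eq_mul, nsmul_eq_mul]
      field_simp
      norm_num
    have h4 := hgp.comp_hasFDerivAt p h3
    refine h4.congr_fderiv ?_
    rw [smul_smul]
    congr 1
    field_simp
  have hgx := key x hx hg.self_of_nhds
  have hgrad : gradient (fun p => g ‖p - q‖) x = (g₁ ‖x - q‖ / ‖x - q‖) • (x - q) := by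
    apply HasGradientAt.gradient
    rw [hasGradientAt_iff_hasFDerivAt]
    refine hgx.congr_fderiv ?_
    ext v
    simp [InnerProductSpace.toDual_apply_apply]
  have hD2 : DifferentiableAt ℝ (fderiv ℝ (fun p => g ‖p - q‖)) x :=
    (hψ.fderiv_right (m := 1) (by norm_num)).differentiableAt (by norm_num)
  -- The gradient is parallel to `x - q`, so only the second derivative along this ray is needed.
  have hline : HasDerivAt (fun t : ℝ => x + t • (x - q)) (x - q) 0 := by
    simpa using ((hasDerivAt_id (0 : ℝ)).smul_const (x - q)).const_add x
  have h0 : x + (0 : ℝ) • (x - q) = x := by simp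
  have hsecond : HasDerivAt (fun t : ℝ => fderiv ℝ (fun p => g ‖p - q‖) (x + t • (x - q)) (x - q))
      (fderiv ℝ (fderiv ℝ (fun p => g ‖p - q‖)) x (x - q) (x - q)) 0 := by
    have h1 : HasFDerivAt (fderiv ℝ (fun p => g ‖p - q‖))
        (fderiv ℝ (fderiv ℝ (fun p => g ‖p - q‖)) x) (x + (0 : ℝ) • (x - q)) := by
      rw [h0]; exact hD2.hasFDerivAt
    have h2 := h1.comp_hasDerivAt (0 : ℝ) hline
    simpa using h2.clm_apply (hasDerivAt_const (0 : ℝ) (x - q))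
  have hscale : HasDerivAt (fun t : ℝ => (1 + t) * ‖x - q‖) ‖x - q‖ 0 := by
    simpa using ((hasDerivAt_id (0 : ℝ)).const_add 1).mul_const ‖x - q‖
  have hsecond' : HasDerivAt (fun t : ℝ => g₁ ((1 + t) * ‖x - q‖) * ‖x - q‖)
      (g₂ * ‖x - q‖ * ‖x - q‖) 0 := by
    have h1 : HasDerivAt g₁ g₂ ((1 + (0 : ℝ)) * ‖x - q‖) := by simpa using hg₁
    exact (h1.comp (0 : ℝ) hscale).mul_const _
  have hev : (fun t : ℝ => fderiv ℝ (fun p => g ‖p - q‖) (x + t • (x - q)) (x - q)) =ᶠ[𝓝 0]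
      fun t => g₁ ((1 + t) * ‖x - q‖) * ‖x - q‖ := by
    have e1 : ∀ᶠ t : ℝ in 𝓝 0, HasDerivAt g (g₁ ((1 + t) * ‖x - q‖)) ((1 + t) * ‖x - q‖) := by
      have := hscale.continuousAt.tendsto
      simp only [add_zero, one_mul] at this
      exact this.eventually hg
    have e2 : ∀ᶠ t : ℝ in 𝓝 0, (-1 : ℝ) < t := eventually_gt_nhds (by norm_num)
    filter_upwards [e1, e2] with t ht1 ht2
    have hsub : x + t • (x - q) - q = (1 + t) • (x - q) := by
      rw [add_smul, one_smul]; abel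
    have hnorm : ‖x + t • (x - q) - q‖ = (1 + t) * ‖x - q‖ := by
      rw [hsub, norm_smul, Real.norm_of_nonneg (by linarith)]
    have ht : 0 < 1 + t := by linarith
    have hne : x + t • (x - q) ≠ q := by
      rw [← sub_ne_zero, ← norm_pos_iff, hnorm]
      positivity
    rw [(key _ hne (by rw [hnorm]; exact ht1)).fderiv, hnorm, hsub]
    simp only [smul_apply, innerSL_apply_apply, smul_eq_mul,
      real_inner_smul_left, real_inner_self_eq_norm_sq]
    field_simp
  have hval := hsecond.unique (hsecond'.congr_of_eventuallyEq hev)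
  unfold infinityLaplacian
  rw [hgrad, map_smul, map_smul, smul_apply, hval]
  simp only [smul_eq_mul]
  field_simp

/-- Positive supersolutions of `Δ_∞ w = c w ^ (-γ)` are such that `(w / A) ^ (1 / α)` is
`1`-Lipschitz from the centre of a ball on which it is small, once `A` is large. -/
lemma rpow_inv_le_add_dist {n : ℕ} {γ A c ρ : ℝ} (hγ0 : 0 ≤ γ) (hγ1 : γ < 1) (hA : 0 < A)
    (hAc : c < A ^ (3 + γ) * (alpha γ ^ 3 * (alpha γ - 1))) (hρ : 0 < ρ)
    {y : EuclideanSpace ℝ (Fin n)} {w : EuclideanSpace ℝ (Fin n) → ℝ}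
    (hcont : ContinuousOn w (Metric.closedBall y ρ))
    (hpos : ∀ z ∈ Metric.closedBall y ρ, 0 < w z)
    (hsup : IsViscositySupersolution (fun s => c * s ^ (-γ)) (Metric.ball y ρ) w)
    (hy : w y < A * ρ ^ alpha γ) :
    ∀ x ∈ Metric.closedBall y ρ,
      (w y / A) ^ (1 / alpha γ) ≤ (w x / A) ^ (1 / alpha γ) + dist x y := by
  set α := alpha γ with hα
  have hα1 : 1 < α := one_lt_alpha hγ0 hγ1
  have hα0 : 0 < α := by linarith
  have hyb : y ∈ Metric.closedBall y ρ := Metric.mem_closedBall_self hρ.le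
  have hrec : ∀ z ∈ Metric.closedBall y ρ, A * ((w z / A) ^ (1 / α)) ^ α = w z := by
    intro z hz
    rw [← Real.rpow_mul (div_pos (hpos z hz) hA).le, one_div_mul_cancel hα0.ne', Real.rpow_one]
    field_simp
  have hWpos : ∀ z ∈ Metric.closedBall y ρ, 0 < (w z / A) ^ (1 / α) := fun z hz =>
    Real.rpow_pos_of_pos (div_pos (hpos z hz) hA) _
  have hWy : (w y / A) ^ (1 / α) < ρ := by
    have h1 : w y / A < ρ ^ α := by rw [div_lt_iff₀ hA]; linarith
    have h2 := Real.rpow_lt_rpow (div_pos (hpos y hyb) hA).le h1 (one_div_pos.2 hα0)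
    rwa [← Real.rpow_mul hρ.le, mul_one_div_cancel hα0.ne', Real.rpow_one] at h2
  have hFcont : ContinuousOn (fun z => (w z / A) ^ (1 / α) + dist z y)
      (Metric.closedBall y ρ) := by
    refine ContinuousOn.add ?_ (by fun_prop)
    exact (hcont.div_const A).rpow_const fun z hz => Or.inr (by positivity)
  obtain ⟨z, hz, hmin⟩ := (isCompact_closedBall y ρ).exists_isMinOn ⟨y, hyb⟩ hFcont
  set m := (w z / A) ^ (1 / α) + dist z y with hm
  have hmle : ∀ x ∈ Metric.closedBall y ρ, m ≤ (w x / A) ^ (1 / α) + dist x y := fun x hx =>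
    hmin hx
  by_contra! hcon
  obtain ⟨x, hx, hxlt⟩ := hcon
  have hmlt : m < (w y / A) ^ (1 / α) := (hmle x hx).trans_lt hxlt
  have hzy : z ≠ y := by
    rintro rfl
    simp [hm] at hmlt
  -- On the sphere the minimized function exceeds `ρ`, hence also its value at `y`.
  have hzball : z ∈ Metric.ball y ρ := by
    rw [Metric.mem_ball]
    have := hWpos z hz
    linarith
  have ht : 0 < m - ‖z - y‖ := by
    rw [← dist_eq_norm, hm, add_sub_cancel_right]
    exact hWpos z hz
  have hgd : ∀ s, s < m → HasDerivAt (fun s => A * (m - s) ^ α)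
      (-(A * α) * (m - s) ^ (α - 1)) s := by
    intro s hs
    have h1 := (((hasDerivAt_id s).const_sub m).rpow_const (p := α)
      (Or.inl (by simpa using (sub_pos.2 hs).ne'))).const_mul A
    refine h1.congr_deriv ?_
    simp only [id]
    ring
  have hg₁d : HasDerivAt (fun s => -(A * α) * (m - s) ^ (α - 1))
      (A * α * (α - 1) * (m - ‖z - y‖) ^ (α - 1 - 1)) ‖z - y‖ := by
    have h1 := (((hasDerivAt_id ‖z - y‖).const_sub m).rpow_const (p := α - 1)
      (Or.inl (by simpa using ht.ne'))).const_mul (-(A * α))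
    refine h1.congr_deriv ?_
    simp only [id]
    ring
  have hψ : ContDiffAt ℝ 2 (fun p : EuclideanSpace ℝ (Fin n) => A * (m - ‖p - y‖) ^ α) z := by
    refine contDiffAt_const.mul (ContDiffAt.rpow_const_of_ne ?_ ht.ne')
    exact contDiffAt_const.sub ((contDiffAt_id.sub contDiffAt_const).norm ℝ (sub_ne_zero.2 hzy))
  have hΔ := infinityLaplacian_radial (g := fun s => A * (m - s) ^ α) hzy
    (by filter_upwards [eventually_lt_nhds (sub_pos.1 ht)] with s hs using hgd s hs) hg₁d hψ
  have hwz : w z = A * (m - ‖z - y‖) ^ α := by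
    rw [← dist_eq_norm, hm, add_sub_cancel_right, hrec z hz]
  -- Minimality of `m` reads `m - |p - y| ≤ (w p / A) ^ (1 / α)`, with equality at `z`; raising it
  -- to the power `α` gives touching from below.
  have hloc : IsLocalMin (fun p => w p - A * (m - ‖p - y‖) ^ α) z := by
    have e1 : ∀ᶠ p in 𝓝 z, p ∈ Metric.ball y ρ := Metric.isOpen_ball.mem_nhds hzball
    have e2 : ∀ᶠ p in 𝓝 z, 0 < m - ‖p - y‖ :=
      (by fun_prop : ContinuousAt (fun p => m - ‖p - y‖) z).eventually (eventually_gt_nhds ht)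
    filter_upwards [e1, e2] with p hp1 hp2
    have hp := Metric.ball_subset_closedBall hp1
    have h1 : m - ‖p - y‖ ≤ (w p / A) ^ (1 / α) := by
      rw [← dist_eq_norm]
      linarith [hmle p hp]
    have h2 := mul_le_mul_of_nonneg_left (Real.rpow_le_rpow hp2.le h1 hα0.le) hA.le
    rw [hrec p hp] at h2
    rw [hwz, sub_self]
    linarith
  have hle := hsup z hzball _ hψ hloc
  rw [hΔ] at hle
  set t := m - ‖z - y‖ with htdef
  simp only [hwz] at hle
  -- The choice of `α` enters here: `(α - 2) + 2 (α - 1) = 3 α - 4 = -α γ`.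
  have hexp : t ^ (α - 1 - 1) * (t ^ (α - 1)) ^ 2 = (t ^ α) ^ (-γ) := by
    rw [← Real.rpow_natCast (t ^ (α - 1)), ← Real.rpow_mul ht.le, ← Real.rpow_add ht,
      ← Real.rpow_mul ht.le]
    congr 1
    have : α * (3 + γ) = 4 := by
      rw [hα, alpha]
      field_simp
    push_cast
    linarith
  have hApow : A ^ (-γ) * A ^ (3 + γ) = A ^ 3 := by
    rw [← Real.rpow_natCast A 3, ← Real.rpow_add hA]
    congr 1
    push_cast
    ring
  have hcalc : A * α * (α - 1) * t ^ (α - 1 - 1) * (-(A * α) * t ^ (α - 1)) ^ 2 =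
      A ^ (3 + γ) * (α ^ 3 * (α - 1)) * (A * t ^ α) ^ (-γ) := by
    rw [Real.mul_rpow hA.le (Real.rpow_nonneg ht.le _), ← hexp]
    calc _ = A ^ 3 * (α ^ 3 * (α - 1)) * (t ^ (α - 1 - 1) * (t ^ (α - 1)) ^ 2) := by ring
      _ = _ := by rw [← hApow]; ring
  rw [hcalc] at hle
  have hp : 0 < (A * t ^ α) ^ (-γ) :=
    Real.rpow_pos_of_pos (mul_pos hA (Real.rpow_pos_of_pos ht _)) _
  exact absurd hle (not_le.2 (mul_lt_mul_of_pos_right hAc hp))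

/-! ### Minimum principle and the penalized source -/

/-- Minimum principle: supersolutions with nonnegative boundary values are nonnegative when the
source vanishes at negative values. -/
lemma IsCompetitor.nonneg {n : ℕ} (hn : 1 ≤ n) {f : ℝ → ℝ} (hf : ∀ s < 0, f s ≤ 0)
    {Ω : Set (EuclideanSpace ℝ (Fin n))} (hΩ : IsOpen Ω) (hΩb : Bornology.IsBounded Ω)
    {φ v : EuclideanSpace ℝ (Fin n) → ℝ} (hφ : ∀ x ∈ frontier Ω, 0 ≤ φ x)
    (hv : IsCompetitor f Ω φ v) : ∀ x ∈ Ω, 0 ≤ v x := by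
  by_contra! hcon
  obtain ⟨x, hx, hvx⟩ := hcon
  have : Nonempty (Fin n) := ⟨⟨0, hn⟩⟩
  have : Nontrivial (EuclideanSpace ℝ (Fin n)) := inferInstance
  obtain ⟨R, hR⟩ := hΩb.closure.subset_closedBall (0 : EuclideanSpace ℝ (Fin n))
  -- A pole outside `closure Ω` keeps the gradient of `κ |p - q| ^ 2` nonzero there, so its infinity
  -- Laplacian is positive.
  obtain ⟨q, hq⟩ := NormedSpace.exists_lt_norm ℝ (EuclideanSpace ℝ (Fin n)) R
  have hqΩ : ∀ z ∈ closure Ω, z ≠ q := by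
    rintro z hz rfl
    have := hR hz
    rw [mem_closedBall_zero_iff] at this
    linarith
  have hcomp : IsCompact (closure Ω) := hΩb.isCompact_closure
  obtain ⟨S, hS⟩ := hcomp.exists_bound_of_continuousOn
    (f := fun z => ‖z - q‖ ^ 2) (by fun_prop)
  have hS' : ∀ z ∈ closure Ω, ‖z - q‖ ^ 2 ≤ S := fun z hz => (le_abs_self _).trans (hS z hz)
  have hSpos : 0 < S := by
    have h1 := hS' x (subset_closure hx)
    have h2 : 0 < ‖x - q‖ := norm_pos_iff.2 (sub_ne_zero.2 (hqΩ x (subset_closure hx)))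
    have h3 : 0 < ‖x - q‖ ^ 2 := by positivity
    linarith
  -- The perturbation stays below `|v x| / 2`, so `v` is still negative at the perturbed minimum,
  -- which is therefore interior.
  obtain ⟨κ, hκ, hκS⟩ : ∃ κ : ℝ, 0 < κ ∧ κ * S = -v x / 2 :=
    ⟨-v x / 2 / S, by have : 0 < -v x := by linarith
                      positivity, by field_simp⟩
  have hκb : ∀ z ∈ closure Ω, κ * ‖z - q‖ ^ 2 ≤ -v x / 2 := fun z hz =>
    hκS ▸ mul_le_mul_of_nonneg_left (hS' z hz) hκ.le
  obtain ⟨z, hz, hmin⟩ := hcomp.exists_isMinOn ⟨x, subset_closure hx⟩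
    (hv.continuousOn.sub (by fun_prop : ContinuousOn (fun z => κ * ‖z - q‖ ^ 2) (closure Ω)))
  have hzx : v z - κ * ‖z - q‖ ^ 2 ≤ v x - κ * ‖x - q‖ ^ 2 := hmin (subset_closure hx)
  have hvz : v z < 0 := by
    have h1 := hκb z hz
    have h2 : 0 ≤ κ * ‖x - q‖ ^ 2 := by positivity
    linarith
  have hzΩ : z ∈ Ω := by
    by_contra hzn
    have hzf : z ∈ frontier Ω := ⟨hz, fun h => hzn (interior_subset h)⟩
    have := hφ z hzf
    rw [← hv.boundary z hzf] at this
    linarith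
  have hloc : IsLocalMin (fun p => v p - κ * ‖p - q‖ ^ 2) z := by
    filter_upwards [hΩ.mem_nhds hzΩ] with p hp using hmin (subset_closure hp)
  have hψ : ContDiffAt ℝ 2 (fun p : EuclideanSpace ℝ (Fin n) => κ * ‖p - q‖ ^ 2) z :=
    contDiffAt_const.mul ((contDiffAt_id.sub contDiffAt_const).norm_sq ℝ)
  have hle := hv.supersolution z hzΩ _ hψ hloc
  have hΔ := infinityLaplacian_radial (g := fun s => κ * s ^ 2) (g₁ := fun s => κ * (2 * s))
    (g₂ := κ * 2) (hqΩ z hz)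
    (Eventually.of_forall fun s => by simpa using (hasDerivAt_pow 2 s).const_mul κ)
    (by simpa using ((hasDerivAt_id ‖z - q‖).const_mul 2).const_mul κ) hψ
  rw [hΔ] at hle
  have hpos : 0 < ‖z - q‖ := norm_pos_iff.2 (sub_ne_zero.2 (hqΩ z hz))
  have : 0 < κ * 2 * (κ * (2 * ‖z - q‖)) ^ 2 := by positivity
  linarith [hf _ hvz]

lemma source_eq_zero {γ δ ε s : ℝ} {B : ℝ → ℝ} (hB : IsPenalization δ B) (hε : 0 < ε)
    (hs : s ≤ δ / 2 * ε ^ alpha γ) : source γ B ε s = 0 := by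
  rw [source, hB.eq_zero _ ((div_le_iff₀ (Real.rpow_pos_of_pos hε _)).2 hs), zero_mul]

/-- Shifting a nonnegative argument by the threshold below which the source vanishes costs at most
a factor `2`. -/
lemma source_le {γ δ ε s : ℝ} {B : ℝ → ℝ} (hγ0 : 0 ≤ γ) (hγ1 : γ < 1) (hδ : 0 < δ)
    (hB : IsPenalization δ B) (hε : 0 < ε) (hs : 0 ≤ s) :
    source γ B ε s ≤ 2 * (s + δ / 2 * ε ^ alpha γ) ^ (-γ) := by
  have hεα : 0 < ε ^ alpha γ := Real.rpow_pos_of_pos hε _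
  have hη : 0 < δ / 2 * ε ^ alpha γ := by positivity
  rcases le_or_gt s (δ / 2 * ε ^ alpha γ) with h | h
  · rw [source_eq_zero hB hε h]
    positivity
  · have hs0 : 0 < s := hη.trans h
    have h1 : source γ B ε s ≤ s ^ (-γ) :=
      mul_le_of_le_one_left (Real.rpow_nonneg hs _) (hB.mem_Icc _ (by positivity)).2
    have h2 : (2 * s) ^ (-γ) ≤ (s + δ / 2 * ε ^ alpha γ) ^ (-γ) :=
      Real.rpow_le_rpow_of_nonpos (by positivity) (by linarith) (by linarith)
    -- This is `2 ^ (1 - γ) ≥ 1`.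
    have h3 : s ^ (-γ) ≤ 2 * (2 * s) ^ (-γ) := by
      rw [Real.mul_rpow (by norm_num) hs, ← mul_assoc]
      refine le_mul_of_one_le_left (Real.rpow_nonneg hs _) ?_
      nth_rewrite 1 [← Real.rpow_one 2]
      rw [← Real.rpow_add (by norm_num)]
      exact Real.one_le_rpow (by norm_num) (by linarith)
    linarith

/-- A supersolution for the source, shifted up, is a supersolution of `Δ_∞ w = 2 w ^ (-γ)`. -/
lemma IsViscositySupersolution.add_const {n : ℕ} {γ δ ε : ℝ} {B : ℝ → ℝ} (hγ0 : 0 ≤ γ)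
    (hγ1 : γ < 1) (hδ : 0 < δ) (hB : IsPenalization δ B) (hε : 0 < ε)
    {Ω U : Set (EuclideanSpace ℝ (Fin n))} (hU : U ⊆ Ω) {v : EuclideanSpace ℝ (Fin n) → ℝ}
    (hv : IsViscositySupersolution (source γ B ε) Ω v) (hv0 : ∀ x ∈ Ω, 0 ≤ v x) :
    IsViscositySupersolution (fun s => 2 * s ^ (-γ)) U
      (fun x => v x + δ / 2 * ε ^ alpha γ) := by
  intro x hx ψ hψ hmin
  refine (hv x (hU hx) ψ hψ ?_).trans (source_le hγ0 hγ1 hδ hB hε (hv0 x (hU hx)))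
  filter_upwards [hmin] with p hp
  linarith

/-- The ball is connected and misses the frontier, so it cannot meet both the interior and the
exterior of `Ω`. -/
lemma ball_subset_of_le_dist_frontier {n : ℕ} {Ω : Set (EuclideanSpace ℝ (Fin n))} {d : ℝ}
    {x : EuclideanSpace ℝ (Fin n)} (hd : 0 < d) (hx : x ∈ Ω)
    (h : ∀ y ∈ frontier Ω, d ≤ dist x y) : Metric.ball x d ⊆ Ω := by
  by_contra hsub
  obtain ⟨z, hz, hzΩ⟩ := not_subset.1 hsub
  have hcl : ∀ p ∈ Metric.ball x d, p ∈ closure Ω → p ∈ interior Ω := fun p hp hpc => by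
    by_contra hpi
    have := h p ⟨hpc, hpi⟩
    rw [Metric.mem_ball, dist_comm] at hp
    linarith
  obtain ⟨p, -, hp₁, hp₂⟩ := (convex_ball x d).isPreconnected (interior Ω) (closure Ω)ᶜ
    isOpen_interior isClosed_closure.isOpen_compl
    (fun p hp => (em (p ∈ closure Ω)).imp (hcl p hp) id)
    ⟨x, Metric.mem_ball_self hd, hcl x (Metric.mem_ball_self hd) (subset_closure hx)⟩
    ⟨z, hz, fun hzc => hzΩ (interior_subset (hcl z hz hzc))⟩
  exact hp₂ (subset_closure (interior_subset hp₁))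

/-- A function continuous on an open set is bounded there by its essential supremum. -/
lemma le_of_eLpNorm_top_le {n : ℕ} {Ω : Set (EuclideanSpace ℝ (Fin n))} (hΩ : IsOpen Ω)
    {u : EuclideanSpace ℝ (Fin n) → ℝ} (hu : ContinuousOn u Ω) {M : ℝ} (hM : 0 ≤ M)
    (h : eLpNorm u ∞ (volume.restrict Ω) ≤ ENNReal.ofReal M) : ∀ x ∈ Ω, u x ≤ M := by
  have hae : ∀ᵐ x ∂(volume.restrict Ω), u x ≤ M := by
    rw [eLpNorm_exponent_top] at h
    filter_upwards [ae_le_eLpNormEssSup (f := u) (μ := volume.restrict Ω)] with x hx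
    have h1 := hx.trans h
    rw [← ofReal_norm, ENNReal.ofReal_le_ofReal_iff hM] at h1
    exact (le_abs_self _).trans h1
  rw [ae_restrict_iff' hΩ.measurableSet] at hae
  have hopen : IsOpen (Ω ∩ u ⁻¹' Ioi M) := hu.isOpen_inter_preimage hΩ isOpen_Ioi
  have hnull : volume (Ω ∩ u ⁻¹' Ioi M) = 0 := by
    refine measure_mono_null ?_ (ae_iff.1 hae)
    rintro x ⟨hx, hxM⟩
    simp only [mem_ofPred_eq, not_forall]
    exact ⟨hx, not_le.2 hxM⟩
  have hempty := (hopen.measure_eq_zero_iff volume).1 hnull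
  intro x hx
  by_contra! hlt
  have : x ∈ Ω ∩ u ⁻¹' Ioi M := ⟨hx, hlt⟩
  simp [hempty] at this

/-! ### Passage to the limit -/

/-- Limits of minimal solutions are such that `(u / A) ^ (1 / α)` is locally
`1`-Lipschitz, with `A` depending only on the size of `u` and the size of the ball. -/
lemma IsLimitSolution.rpow_inv_le_add_dist {n : ℕ} (hn : 1 ≤ n) {γ δ A ρ : ℝ} {B : ℝ → ℝ}
    (hγ0 : 0 ≤ γ) (hγ1 : γ < 1) (hδ : 0 < δ) (hB : IsPenalization δ B) (hA : 0 < A)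
    (hAc : 2 < A ^ (3 + γ) * (alpha γ ^ 3 * (alpha γ - 1))) (hρ : 0 < ρ)
    {Ω : Set (EuclideanSpace ℝ (Fin n))} (hΩ : IsOpen Ω) (hΩb : Bornology.IsBounded Ω)
    {φ u : EuclideanSpace ℝ (Fin n) → ℝ} (hu : IsLimitSolution γ B Ω φ u)
    {y : EuclideanSpace ℝ (Fin n)} (hball : Metric.closedBall y ρ ⊆ Ω)
    (hy : u y < A * ρ ^ alpha γ) :
    ∀ x ∈ Metric.closedBall y ρ,
      (u y / A) ^ (1 / alpha γ) ≤ (u x / A) ^ (1 / alpha γ) + dist x y := by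
  intro x hx
  obtain ⟨-, ε, φ', v, hε, hε0, hφ', -, hmin, hlim⟩ := hu
  have hα0 : 0 < alpha γ := by linarith [one_lt_alpha hγ0 hγ1]
  have hyb : y ∈ Metric.closedBall y ρ := Metric.mem_closedBall_self hρ.le
  have hη : Tendsto (fun k => δ / 2 * ε k ^ alpha γ) atTop (𝓝 0) := by
    have := (hε0.rpow_const (p := alpha γ) (Or.inr hα0.le)).const_mul (δ / 2)
    simpa [Real.zero_rpow hα0.ne'] using this
  have hw : ∀ z ∈ Ω, Tendsto (fun k => v k z + δ / 2 * ε k ^ alpha γ) atTop (𝓝 (u z)) := by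
    intro z hz
    simpa using (hlim.tendsto_at hz).add hη
  have hroot : ∀ z ∈ Ω, Tendsto (fun k => ((v k z + δ / 2 * ε k ^ alpha γ) / A) ^ (1 / alpha γ))
      atTop (𝓝 ((u z / A) ^ (1 / alpha γ))) := fun z hz =>
    ((hw z hz).div_const A).rpow_const (Or.inr (by positivity))
  refine le_of_tendsto_of_tendsto (hroot y (hball hyb)) ((hroot x (hball hx)).add_const _) ?_
  -- The smallness condition at `y` is strict, so it holds for all large `k`.
  filter_upwards [(hw y (hball hyb)).eventually (eventually_lt_nhds hy)] with k hk
  have hv := (hmin k).isCompetitor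
  have hv0 : ∀ z ∈ Ω, 0 ≤ v k z := hv.nonneg hn
    (fun s hs => (source_eq_zero hB (hε k) (hs.le.trans
      (by have := Real.rpow_pos_of_pos (hε k) (alpha γ)
          positivity))).le) hΩ hΩb (hφ' k)
  refine SingularInfinity.rpow_inv_le_add_dist hγ0 hγ1 hA hAc hρ
    (w := fun z => v k z + δ / 2 * ε k ^ alpha γ) ?_ ?_ ?_ hk x hx
  · exact (hv.continuousOn.mono (hball.trans subset_closure)).add continuousOn_const
  · intro z hz
    have h1 := hv0 z (hball hz)
    have h2 := Real.rpow_pos_of_pos (hε k) (alpha γ)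
    positivity
  · exact hv.supersolution.add_const hγ0 hγ1 hδ hB (hε k)
      (Metric.ball_subset_closedBall.trans hball) hv0

lemma IsLimitSolution.continuousOn {n : ℕ} {γ : ℝ} {B : ℝ → ℝ}
    {Ω : Set (EuclideanSpace ℝ (Fin n))} {φ u : EuclideanSpace ℝ (Fin n) → ℝ}
    (hu : IsLimitSolution γ B Ω φ u) : ContinuousOn u Ω := by
  obtain ⟨-, ε, φ', v, -, -, -, -, hmin, hlim⟩ := hu
  exact hlim.continuousOn (Frequently.of_forall fun k =>
    (hmin k).isCompetitor.continuousOn.mono subset_closure)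

lemma IsLimitSolution.nonneg {n : ℕ} (hn : 1 ≤ n) {γ δ : ℝ} {B : ℝ → ℝ} (hδ : 0 < δ)
    (hB : IsPenalization δ B) {Ω : Set (EuclideanSpace ℝ (Fin n))} (hΩ : IsOpen Ω)
    (hΩb : Bornology.IsBounded Ω) {φ u : EuclideanSpace ℝ (Fin n) → ℝ}
    (hu : IsLimitSolution γ B Ω φ u) : ∀ x ∈ Ω, 0 ≤ u x := by
  intro x hx
  obtain ⟨-, ε, φ', v, hε, -, hφ', -, hmin, hlim⟩ := hu
  refine ge_of_tendsto' (hlim.tendsto_at hx) fun k => (hmin k).isCompetitor.nonneg hn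
    (fun s hs => (source_eq_zero hB (hε k) (hs.le.trans
      (by have := Real.rpow_pos_of_pos (hε k) (alpha γ)
          positivity))).le) hΩ hΩb (hφ' k) x hx

end SingularInfinity

/-! ### The growth estimate -/

theorem proposition5p1 (n : ℕ) (hn : 1 ≤ n) (γ : ℝ) (hγ0 : 0 ≤ γ) (hγ1 : γ < 1)
    (M d : ℝ) (hM : 0 ≤ M) (hd : 0 < d) :
    ∃ C r₀ : ℝ, 0 < C ∧ 0 < r₀ ∧
      ∀ (δ : ℝ) (B : ℝ → ℝ), 0 < δ → SingularInfinity.IsPenalization δ B →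
      ∀ Ω Ω' : Set (EuclideanSpace ℝ (Fin n)),
        IsOpen Ω → IsConnected Ω → Bornology.IsBounded Ω →
        IsOpen Ω' → IsConnected Ω' → closure Ω' ⊆ Ω →
        (∀ x ∈ Ω', ∀ y ∈ frontier Ω, d ≤ dist x y) →
      ∀ φ u : EuclideanSpace ℝ (Fin n) → ℝ,
        SingularInfinity.IsLimitSolution γ B Ω φ u →
        eLpNorm u ∞ (volume.restrict Ω) ≤ ENNReal.ofReal M →
      ∀ r : ℝ, 0 < r → r ≤ r₀ →
      ∀ x ∈ closure {y ∈ Ω | u y < r ^ SingularInfinity.alpha γ} ∩ Ω',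
        Metric.ball x r ⊆ Ω ∧
        ∀ y ∈ Metric.ball x r, u y ≤ C * r ^ SingularInfinity.alpha γ := by
  set α := SingularInfinity.alpha γ with hα
  have hα1 : 1 < α := SingularInfinity.one_lt_alpha hγ0 hγ1
  have hα0 : 0 < α := by linarith
  -- The second condition makes the barrier strict for `c = 2`; the third gives `u y < A ρ ^ α` with
  -- `ρ = d / 4`.
  obtain ⟨A, hA, hAc, hAM⟩ : ∃ A : ℝ, 0 < A ∧ 2 < A ^ (3 + γ) * (α ^ 3 * (α - 1)) ∧
      M < A * (d / 4) ^ α := by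
    have hc : 0 < α ^ 3 * (α - 1) := mul_pos (by positivity) (by linarith)
    have h1 : Tendsto (fun A : ℝ => A ^ (3 + γ) * (α ^ 3 * (α - 1))) atTop atTop :=
      (tendsto_rpow_atTop (by linarith)).atTop_mul_const hc
    have h2 : Tendsto (fun A : ℝ => A * (d / 4) ^ α) atTop atTop :=
      tendsto_id.atTop_mul_const (by positivity)
    exact ((eventually_gt_atTop 0).and
      ((h1.eventually_gt_atTop 2).and (h2.eventually_gt_atTop M))).exists
  refine ⟨A * ((1 / A) ^ (1 / α) + 1) ^ α, d / 4, by positivity, by positivity, ?_⟩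
  intro δ B hδ hB Ω Ω' hΩ _ hΩb _ _ hΩ' hdist φ u hu hnorm r hr hr₀ x ⟨hxcl, hxΩ'⟩
  have hxΩ : x ∈ Ω := hΩ' (subset_closure hxΩ')
  have hball : Metric.ball x d ⊆ Ω :=
    SingularInfinity.ball_subset_of_le_dist_frontier hd hxΩ (hdist x hxΩ')
  have hcont := hu.continuousOn
  refine ⟨(Metric.ball_subset_ball (by linarith)).trans hball, fun y hy => ?_⟩
  have hyx : dist x y < r := by rwa [dist_comm]
  -- Since `r ≤ d / 4`, this ball lies within distance `d / 2` of `x`, and it contains `x`.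
  have hyb : Metric.closedBall y (d / 4) ⊆ Ω := by
    refine Subset.trans (fun z hz => ?_) hball
    rw [Metric.mem_closedBall] at hz
    rw [Metric.mem_ball]
    linarith [dist_triangle z y x, dist_comm x y]
  have hyΩ : y ∈ Ω := hyb (Metric.mem_closedBall_self (by positivity))
  have huM := SingularInfinity.le_of_eLpNorm_top_le hΩ hcont hM hnorm y hyΩ
  have hux : u x ≤ r ^ α := by
    have h1 : ContinuousWithinAt u {y ∈ Ω | u y < r ^ α} x :=
      (hcont x hxΩ).mono fun z hz => hz.1
    exact h1.closure_le hxcl continuousWithinAt_const fun z hz => hz.2.le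
  have hu0 := hu.nonneg hn hδ hB hΩ hΩb
  have hlip := hu.rpow_inv_le_add_dist hn hγ0 hγ1 hδ hB hA hAc (by positivity) hΩ hΩb hyb
    (huM.trans_lt hAM) x (Metric.mem_closedBall.2 (by linarith))
  rw [← hα] at hlip
  have hxroot : (u x / A) ^ (1 / α) ≤ (1 / A) ^ (1 / α) * r := by
    have h1 : u x / A ≤ 1 / A * r ^ α := by
      rw [one_div_mul_eq_div]
      gcongr
    calc (u x / A) ^ (1 / α) ≤ (1 / A * r ^ α) ^ (1 / α) :=
          Real.rpow_le_rpow (div_nonneg (hu0 x hxΩ) hA.le) h1 (by positivity)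
      _ = (1 / A) ^ (1 / α) * r := by
          rw [Real.mul_rpow (by positivity) (by positivity), ← Real.rpow_mul hr.le,
            mul_one_div_cancel hα0.ne', Real.rpow_one]
  have hyroot : (u y / A) ^ (1 / α) ≤ ((1 / A) ^ (1 / α) + 1) * r := by linarith
  have hyA : 0 ≤ u y / A := div_nonneg (hu0 y hyΩ) hA.le
  have hfin := Real.rpow_le_rpow (by positivity) hyroot hα0.le
  rw [← Real.rpow_mul hyA, one_div_mul_cancel hα0.ne', Real.rpow_one,
    Real.mul_rpow (by positivity) hr.le, div_le_iff₀ hA] at hfin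
  linarith
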